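/- **Model.** There are $n$ nodes, of which a proportion $q$ is adversarial; the $(1-q)n\ge 1$ remaining nodes are honest. The parameters of the protocol are integers $k,m_0,\ell\ge 1$ and reals $1/2<a\le b<1$, $0<\beta<1/2$. Each honest node $j$ starts with an opinion in $\{0,1\}$; let $\hat p_0$ be the initial proportion of $1$-opinions among the honest nodes. In each round $m=1,2,\dots$ each honest node $j$ sends $k$ queries to nodes chosen independently and uniformly among all $n$ nodes (repetitions and self-queries allowed). A queried honest node answers its opinion after the previous round. A queried adversarial node answers whatever the adversary wants, possibly differently to different queries in the same round; the (possibly randomized) strategy of the adversary may depend on everything that happened before and on the queries of the current round, but not on the current or later thresholds nor on later queries. Let $\eta_m(j)$ be the number of answers $1$ that $j$ receives. After that a common random threshold $X_m$, independent of everything before, is drawn, with $X_1\sim U[a,b]$ and $X_m\sim U[\beta,1-\beta]$ for $m\ge 2$. Each honest node $j$ without a final opinion adopts opinion $1$ if $k^{-1}\eta_m(j)\ge X_m$ and opinion $0$ otherwise. An opinion of an honest node becomes final, and is never changed afterwards, once the node has had it in $\ell$ consecutive rounds, all of them with number at least $m_0+1$. Let $H_i$ be the event that all honest nodes eventually reach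 the final opinion $i$, and $\mathcal N\in\mathbb N\cup\{\infty\}$ the number of rounds until all honest nodes have final opinions. **Theorem 2.** Suppose that $q<\beta$. Put $\varepsilon=e^{-\frac12k(\beta-q)^2}$ and $\varphi=\frac{\beta-q}{2(1-q)}-\varepsilon$, and suppose that $k$ is so large that $\varphi>0$. For an integer $u\ge 0$ let $$W=(1-q)n\Big(\big(1-(1-\varepsilon)^\ell\big)^u+\Big(\frac{\varepsilon}{1-\varepsilon}\Big)^{\ell-1}\Big)+(m_0+\ell u)\,e^{-2(1-q)n\varphi^2}.$$ Then for every strategy of the adversary (cautious or berserk) the following holds. (i) If $\hat p_0(1-q)+q<a$ and $e^{-2k(a-\hat p_0(1-q)-q)^2}\le\frac{\beta-q}{4(1-q)}$, then $$\mathbb P\big[H_0\cap\{\mathcal N\le m_0+\ell u\}\big]\ \ge\ 1-\exp\Big(-\tfrac18 n\,\tfrac{(\beta-q)^2}{4(1-q)}\Big)-W.$$ (ii) If $\hat p_0(1-q)>b$ and $e^{-2k(\hat p_0(1-q)-b)^2}\le\frac{\beta-q}{4(1-q)}$, then $$\mathbb P\big[H_1\cap\{\mathcal N\le m_0+\ell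 u\}\big]\ \ge\ 1-\exp\Big(-\tfrac18 n\,\tfrac{(\beta-q)^2}{4(1-q)}\Big)-W.$$ -/

import Mathlib

open MeasureTheory ProbabilityTheory

noncomputable section

/-- The parameters of the protocol.  There are `n` nodes, `numHonest` of them honest; each node
issues `k` queries per round; `a`, `b` and `β` are the threshold limits, `m₀` is the cooling-off
period and `ℓ` the number of consecutive equal opinions after which an opinion is final. -/
structure FPCParams where
  n : ℕ
  numHonest : ℕ
  k : ℕ
  m₀ : ℕ
  ℓ : ℕ
  a : ℝ
  b : ℝ
  β : ℝ
  numHonest_pos : 0 < numHonest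
  numHonest_le : numHonest ≤ n
  k_pos : 0 < k
  m₀_pos : 0 < m₀
  ℓ_pos : 0 < ℓ
  half_lt_a : 1 / 2 < a
  a_le_b : a ≤ b
  b_lt_one : b < 1
  β_pos : 0 < β
  β_lt_half : β < 1 / 2

/-- The uniform distribution on the interval `[c, d]`, `c ≤ d`, as the image of the uniform
distribution on `[0, 1]`; it is the point mass at `c` if `c = d`. -/
def uniformInterval (c d : ℝ) : Measure ℝ :=
  (volume : Measure unitInterval).map fun t : unitInterval => c + (d - c) * (t : ℝ)

instance (c d : ℝ) : IsProbabilityMeasure (uniformInterval c d) :=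
  Measure.isProbabilityMeasure_map (by fun_prop)

namespace FPCParams

variable (p : FPCParams)

/-- The proportion of adversarial nodes. -/
def q : ℝ := ((p.n : ℝ) - p.numHonest) / p.n

/-- The honest nodes. -/
abbrev Honest : Type := Fin p.numHonest

/-- All nodes; those with an index below `numHonest` are honest, the others adversarial. -/
abbrev Node : Type := Fin p.n

instance : Nonempty p.Node := ⟨⟨0, p.numHonest_pos.trans_le p.numHonest_le⟩⟩

/-- The queries of one round: `Q j i` is the node that receives the `i`-th query of the honest
node `j`. -/
abbrev Queries : Type := p.Honest → Fin p.k → p.Node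

/-- A bit for each query of each honest node. -/
abbrev Replies : Type := p.Honest → Fin p.k → Bool

/-- The randomness of one round: the queries and the common random threshold. -/
abbrev Round : Type := p.Queries × ℝ

instance : IsProbabilityMeasure (uniformOn (Set.univ : Set p.Node)) :=
  isProbabilityMeasure_uniformOn Set.finite_univ Set.univ_nonempty

/-- All queries are independent and uniform among all the nodes (repetitions and self-queries
are allowed). -/
def queriesLaw : Measure p.Queries :=
  Measure.pi fun _ => Measure.pi fun _ => uniformOn (Set.univ : Set p.Node)

instance : IsProbabilityMeasure p.queriesLaw := by
  unfold queriesLaw; infer_instance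

/-- The law of the threshold of round `m + 1`: it is `U[a, b]` in the first round and
`U[β, 1 - β]` in all later rounds. -/
def thresholdLaw (m : ℕ) : Measure ℝ :=
  if m = 0 then uniformInterval p.a p.b else uniformInterval p.β (1 - p.β)

instance (m : ℕ) : IsProbabilityMeasure (p.thresholdLaw m) := by
  unfold thresholdLaw; split_ifs <;> infer_instance

/-- The randomness of all rounds; the coordinate `m` belongs to round `m + 1`. -/
abbrev Path : Type := ℕ → p.Round

/-- The rounds are independent, and in each round the threshold is independent of the queries. -/
def pathLaw : Measure p.Path :=
  Measure.infinitePi fun m => p.queriesLaw.prod (p.thresholdLaw m)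

instance : IsProbabilityMeasure p.pathLaw := by
  unfold pathLaw; infer_instance

/-- A strategy of an omniscient (berserk) adversary with private randomness in `S`.  In round
`m + 1` he knows his private randomness, everything that happened in the `m` previous rounds
(which determines the opinions of all honest nodes) and the queries of the current round, but
neither the threshold of the current round nor anything that comes later.  He chooses a reply to
every single query; different replies of the same node in the same round are allowed.  The
reply is used only if the query is addressed to an adversarial node.  A cautious adversary is
the special case where the reply depends on the node that is queried and not on the rest of the
current queries. -/
structure Strategy (S : Type*) [MeasurableSpace S] where
  reply : (m : ℕ) → S × (Fin m → p.Round) × p.Queries → p.Replies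
  measurable_reply : ∀ m, Measurable (reply m)

/-- The state of the honest nodes after a round: their opinions, and for how many consecutive
rounds after the cooling-off period they have had their present opinion. -/
structure State where
  opinion : p.Honest → Bool
  streak : p.Honest → ℕ

variable {p}

/-- The answer to a query addressed to `v`: an honest node tells its opinion, an adversarial node
gives the reply `r` chosen by the adversary. -/
def answer (opinion : p.Honest → Bool) (v : p.Node) (r : Bool) : Bool :=
  if h : (v : ℕ) < p.numHonest then opinion ⟨v, h⟩ else r

/-- The number `η(j)` of `1`-opinions that the honest node `j` receives in a round. -/
def eta (opinion : p.Honest → Bool) (Q : p.Queries) (r : p.Replies) (j : p.Honest) : ℕ :=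
  (Finset.univ.filter fun i : Fin p.k => answer opinion (Q j i) (r j i) = true).card

/-- The state after round `m + 1`, given the state `s` before it, the queries `Q`, the
threshold `x` and the replies `r` of the adversary. A node whose opinion is final keeps it. -/
def step (m : ℕ) (s : State p) (Q : p.Queries) (x : ℝ) (r : p.Replies) : State p :=
  let new : p.Honest → Bool := fun j =>
    if p.ℓ ≤ s.streak j then s.opinion j
    else decide (x ≤ (eta s.opinion Q r j : ℝ) / p.k)
  { opinion := new
    streak := fun j =>
      if m + 1 ≤ p.m₀ then 0
      else if new j = s.opinion j then s.streak j + 1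
      else 1 }

variable {S : Type*} [MeasurableSpace S]

/-- The state of the honest nodes after round `m`, when they start with the opinions `ξ₀`. -/
def state (ξ₀ : p.Honest → Bool) (A : p.Strategy S) (ω : S × p.Path) : ℕ → State p
  | 0 => { opinion := ξ₀, streak := fun _ => 0 }
  | m + 1 =>
    step m (state ξ₀ A ω m) (ω.2 m).1 (ω.2 m).2
      (A.reply m (ω.1, (fun i : Fin m => ω.2 i), (ω.2 m).1))

/-- The opinion of the honest node `j` after round `m`. -/
def opinion (ξ₀ : p.Honest → Bool) (A : p.Strategy S) (ω : S × p.Path) (m : ℕ)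
    (j : p.Honest) : Bool :=
  (state ξ₀ A ω m).opinion j

/-- The opinion of the honest node `j` is final after round `m`. -/
def IsFinal (ξ₀ : p.Honest → Bool) (A : p.Strategy S) (ω : S × p.Path) (m : ℕ)
    (j : p.Honest) : Prop :=
  p.ℓ ≤ (state ξ₀ A ω m).streak j

/-- An opinion is final if and only if it was the same in the last `ℓ` rounds, all of them after
the cooling-off period. -/
theorem isFinal_iff (ξ₀ : p.Honest → Bool) (A : p.Strategy S) (ω : S × p.Path) (m : ℕ)
    (j : p.Honest) :
    IsFinal ξ₀ A ω m j ↔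
      p.m₀ + p.ℓ ≤ m ∧ ∀ i < p.ℓ, opinion ξ₀ A ω (m - i) j = opinion ξ₀ A ω m j := by
  suffices h : ∀ r, 0 < r → (r ≤ (state ξ₀ A ω m).streak j ↔
      p.m₀ + r ≤ m ∧ ∀ i < r, opinion ξ₀ A ω (m - i) j = opinion ξ₀ A ω m j) from h _ p.ℓ_pos
  have hm₀ := p.m₀_pos
  induction m with
  | zero => intro r hr; simp [state]; omega
  | succ m ih =>
    intro r hr
    have hs : (state ξ₀ A ω (m + 1)).streak j =
        if m + 1 ≤ p.m₀ then 0
        else if opinion ξ₀ A ω (m + 1) j = opinion ξ₀ A ω m j then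
          (state ξ₀ A ω m).streak j + 1
        else 1 := rfl
    rw [hs]
    split_ifs with h1 h2
    · constructor
      · omega
      · rintro ⟨h, -⟩; omega
    · obtain _ | _ | r := r
      · omega
      · simp; omega
      · rw [Nat.add_le_add_iff_right, ih (r + 1) (by omega)]
        constructor
        · rintro ⟨h3, h4⟩
          refine ⟨by omega, fun i hi => ?_⟩
          obtain _ | i := i
          · rfl
          · rw [h2, Nat.add_sub_add_right]; exact h4 i (by omega)
        · rintro ⟨h3, h4⟩
          refine ⟨by omega, fun i hi => ?_⟩
          have := h4 (i + 1) (by omega)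
          rwa [h2, Nat.add_sub_add_right] at this
    · obtain _ | _ | r := r
      · omega
      · simp; omega
      · constructor
        · omega
        · rintro ⟨-, h4⟩
          exact absurd (h4 1 (by omega)).symm h2

/-- The event `H_i` that all honest nodes eventually reach the final opinion `i`. -/
def finalConsensus (ξ₀ : p.Honest → Bool) (A : p.Strategy S) (i : Bool) : Set (S × p.Path) :=
  {ω | ∀ j, ∃ m, IsFinal ξ₀ A ω m j ∧ opinion ξ₀ A ω m j = i}

/-- The number of rounds until all honest nodes have their final opinions; it is infinite if
this never happens. -/
def numRounds (ξ₀ : p.Honest → Bool) (A : p.Strategy S) (ω : S × p.Path) : ℕ∞ :=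
  ⨅ (m : ℕ) (_ : ∀ j, IsFinal ξ₀ A ω m j), (m : ℕ∞)

/-- The initial proportion of `1`-opinions among the honest nodes. -/
def initialProportion (ξ₀ : p.Honest → Bool) : ℝ :=
  ((Finset.univ.filter fun j => ξ₀ j = true).card : ℝ) / p.numHonest

variable (p)

/-- The quantity `φ_{β,q,k}`. -/
def phi : ℝ :=
  (p.β - p.q) / (2 * (1 - p.q)) - Real.exp (-(1 / 2) * p.k * (p.β - p.q) ^ 2)

/-- The quantity `W(n, k, m₀, ℓ, u)`. -/
def W (u : ℕ) : ℝ :=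
  (1 - p.q) * p.n *
      ((1 - (1 - Real.exp (-(1 / 2) * p.k * (p.β - p.q) ^ 2)) ^ p.ℓ) ^ u
        + (Real.exp (-(1 / 2) * p.k * (p.β - p.q) ^ 2)
            / (1 - Real.exp (-(1 / 2) * p.k * (p.β - p.q) ^ 2))) ^ (p.ℓ - 1))
    + ((p.m₀ : ℝ) + p.ℓ * u) * Real.exp (-2 * (1 - p.q) * p.n * p.phi ^ 2)

end FPCParams

end

/-!
The adversary cannot influence which nodes are queried.  Fix the target opinion `t`, and call a
node contrary if it is adversarial or has another opinion than `t`.  Whatever the replies are, an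
honest node without a final opinion can only adopt an opinion other than `t` after the first round
if at least `β * k` of its queries go to contrary nodes; it is then called misled.  (In the first
round `β` is replaced by `a` or `1 - b`.)  The set of contrary nodes is determined by the past and
the queries are independent of the past, so as long as at most a proportion `(β + q) / 2` of the
nodes is contrary, the honest nodes are misled independently of each other given the past, each
with probability at most `ε`, by Hoeffding's inequality (`real_hits_β_le`).  To have these bounds
without any condition on the past, the set of contrary nodes is replaced by the empty set when it
is too big (`suspects`); then three estimates hold.

* A second application of Hoeffding's inequality, over the nodes, bounds the probability that
  a proportion `ε + φ` of the honest nodes is misled in a given round (`real_card_misled_le`, and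
  `real_card_misled_zero_le` for the first round).
* For a given node, each of `u` blocks of `ℓ` rounds contains a round in which it is misled with
  probability at most `(1 - (1 - ε) ^ ℓ) ^ u` (`AdaptedBits.forall_block_exists_le`).
* A given node is misled `ℓ` times in a row before it is not misled `ℓ` times in a row with
  probability at most `(ε / (1 - ε)) ^ (ℓ - 1)` (`AdaptedBits.race_le`).  For independent bits the
  probability of this event is an explicit function of the current run, and it is larger after
  a misled round than after another one; therefore it is a supermartingale for bits with smaller
  conditional probabilities.

If none of these events happens (`Good`), then by induction over the rounds no opinion other than
`t` becomes final and at most a proportion `(β + q) / 2` of the nodes is contrary, so that the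
truncation is never active, and every node gets the final opinion `t` at the latest in one of the
blocks in which it is not misled (`Good.controls`, `Good.isFinal`).  The theorem is the union bound.
-/

noncomputable section

/-! ### Hoeffding's inequality for the number of successes -/

/-- **Hoeffding's inequality** for the number of coordinates of a product measure that lie in a set
of probability at most `x`. -/
theorem measureReal_pi_count_ge_le {ι α : Type*} [Fintype ι] [MeasurableSpace α] (μ : Measure α)
    [IsProbabilityMeasure μ] {C : Set α} [DecidablePred (· ∈ C)] (hC : MeasurableSet C) {x t : ℝ}
    (hx : μ.real C ≤ x) (ht : 0 ≤ t) :
    (Measure.pi fun _ : ι => μ).real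
        {ω | (x + t) * Fintype.card ι ≤ ((Finset.univ.filter fun i => ω i ∈ C).card : ℝ)}
      ≤ Real.exp (-2 * Fintype.card ι * t ^ 2) := by
  classical
  rcases isEmpty_or_nonempty ι with hι | hι
  · simp
  have hcard : 0 < (Fintype.card ι : ℝ) := by exact_mod_cast Fintype.card_pos
  set f : α → ℝ := C.indicator 1 with hf
  have hfm : Measurable f := measurable_one.indicator hC
  have hfI : ∀ y, f y ∈ Set.Icc (0 : ℝ) 1 := by
    intro y
    by_cases hy : y ∈ C <;> simp [hf, hy]
  have hmean : ∫ y, f y ∂μ = μ.real C := integral_indicator_one hC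
  have hind : iIndepFun (fun (i : ι) (ω : ι → α) => f (ω i) - μ.real C)
      (Measure.pi fun _ : ι => μ) :=
    iIndepFun_pi (X := fun (_ : ι) y => f y - μ.real C)
      fun _ => (hfm.sub_const _).aemeasurable
  have hsub : ∀ i ∈ (Finset.univ : Finset ι),
      HasSubgaussianMGF (fun ω : ι → α => f (ω i) - μ.real C) ((‖(1 : ℝ) - 0‖₊ / 2) ^ 2)
        (Measure.pi fun _ : ι => μ) := by
    intro i _
    have hi : ∫ ω, f (ω i) ∂(Measure.pi fun _ : ι => μ) = μ.real C := by
      rw [integral_comp_eval (μ := fun _ : ι => μ) (i := i) hfm.aestronglyMeasurable, hmean]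
    have := hasSubgaussianMGF_of_mem_Icc (μ := Measure.pi fun _ : ι => μ)
      (X := fun ω => f (ω i)) (hfm.comp (measurable_pi_apply i)).aemeasurable
      (Filter.Eventually.of_forall fun ω => hfI (ω i))
    rwa [hi] at this
  refine (measureReal_mono ?_).trans ((HasSubgaussianMGF.measure_sum_ge_le_of_iIndepFun hind hsub
    (ε := t * Fintype.card ι) (by positivity)).trans (le_of_eq ?_))
  · intro ω hω
    have hsum : ∑ i, f (ω i) = ((Finset.univ.filter fun i => ω i ∈ C).card : ℝ) := by
      simp [hf, Set.indicator_apply, Finset.sum_boole]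
    simp only [Set.mem_ofPred_eq, Finset.sum_sub_distrib, Finset.sum_const, Finset.card_univ,
      nsmul_eq_mul] at hω ⊢
    rw [hsum]
    nlinarith
  · congr 1
    simp
    field_simp

/-! ### Adapted random bits -/

/-- `AdaptedBits μ F b m₁ ε`: the random bits `b m` are adapted, `b m` being known at time `m + 1`,
and from time `m₁` on the conditional probability of `b m = true`, given the past `F m`, is at most
`ε`.  The bound on the conditional probability is written as a bound on all events of the past. -/
structure AdaptedBits {Ω : Type*} {mΩ : MeasurableSpace Ω} (μ : Measure Ω) (F : Filtration ℕ mΩ)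
    (b : ℕ → Ω → Bool) (m₁ : ℕ) (ε : ℝ) : Prop where
  measurableSet : ∀ m, MeasurableSet[F (m + 1)] {ω | b m ω = true}
  le : ∀ m, m₁ ≤ m → ∀ A, MeasurableSet[F m] A → μ.real (A ∩ {ω | b m ω = true}) ≤ ε * μ.real A

namespace AdaptedBits

variable {Ω : Type*} {mΩ : MeasurableSpace Ω} {μ : Measure Ω}
  {F : Filtration ℕ mΩ} {b : ℕ → Ω → Bool} {m₁ : ℕ} {ε : ℝ}

theorem inter_measurable (h : AdaptedBits μ F b m₁ ε) {m : ℕ} {A : Set Ω}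
    (hA : MeasurableSet[F m] A) : MeasurableSet[F (m + 1)] (A ∩ {ω | b m ω = true}) :=
  (F.mono m.le_succ _ hA).inter (h.measurableSet m)

theorem diff_measurable (h : AdaptedBits μ F b m₁ ε) {m : ℕ} {A : Set Ω}
    (hA : MeasurableSet[F m] A) : MeasurableSet[F (m + 1)] (A \ {ω | b m ω = true}) :=
  (F.mono m.le_succ _ hA).diff (h.measurableSet m)

theorem measurableSet_of_lt (h : AdaptedBits μ F b m₁ ε) {i m : ℕ} (hi : i < m) :
    MeasurableSet[F m] {ω | b i ω = true} :=
  F.mono (Nat.succ_le_of_lt hi) _ (h.measurableSet i)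

variable [IsFiniteMeasure μ]

/-- If the value `v₁` after a `true` bit is not below the value `v₀` after a `false` bit, a random
bit that is `true` with conditional probability at most `ε` is worth at most
`ε * v₁ + (1 - ε) * v₀`. -/
theorem inter_le (h : AdaptedBits μ F b m₁ ε) {m : ℕ} (hm : m₁ ≤ m) {A E : Set Ω}
    (hA : MeasurableSet[F m] A) {v₀ v₁ : ℝ} (hv : v₀ ≤ v₁)
    (h₁ : μ.real ((A ∩ {ω | b m ω = true}) ∩ E) ≤ v₁ * μ.real (A ∩ {ω | b m ω = true}))
    (h₀ : μ.real ((A \ {ω | b m ω = true}) ∩ E) ≤ v₀ * μ.real (A \ {ω | b m ω = true})) :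
    μ.real (A ∩ E) ≤ (ε * v₁ + (1 - ε) * v₀) * μ.real A := by
  have hB : MeasurableSet {ω | b m ω = true} := F.le _ _ (h.measurableSet m)
  -- The left side is at most `v₀ * μ A + (v₁ - v₀) * μ (A ∩ {b m = true})`.
  have hsplit := measureReal_inter_add_sdiff (μ := μ) (s := A) hB
  have hsplit' := measureReal_inter_add_sdiff (μ := μ) (s := A ∩ E) hB
  rw [Set.inter_right_comm, show (A ∩ E) \ {ω | b m ω = true} = (A \ {ω | b m ω = true}) ∩ E by
      ext; simp only [Set.mem_inter_iff, Set.mem_sdiff]; tauto] at hsplit'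
  have hle := mul_le_mul_of_nonneg_left (h.le m hm A hA) (sub_nonneg.2 hv)
  rw [← eq_sub_iff_add_eq'] at hsplit
  rw [hsplit] at h₀
  linarith

/-- In a block of length `r` some bit is `true` with conditional probability at most
`1 - (1 - ε) ^ r`. -/
theorem inter_exists_le (h : AdaptedBits μ F b m₁ ε) (hε : ε ≤ 1) (r : ℕ) :
    ∀ {m : ℕ}, m₁ ≤ m → ∀ {A : Set Ω}, MeasurableSet[F m] A →
      μ.real (A ∩ {ω | ∃ i < r, b (m + i) ω = true}) ≤ (1 - (1 - ε) ^ r) * μ.real A := by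
  induction r with
  | zero => intro m _ A _; simp
  | succ r ih =>
    intro m hm A hA
    have hpow : 0 ≤ (1 - ε) ^ r := pow_nonneg (by linarith) r
    refine (h.inter_le hm hA (v₁ := 1) (v₀ := 1 - (1 - ε) ^ r) (by linarith) ?_ ?_).trans
      (le_of_eq ?_)
    · rw [one_mul]
      exact measureReal_mono Set.inter_subset_left
    · refine (measureReal_mono ?_).trans (ih (hm.trans m.le_succ) (h.diff_measurable hA))
      rintro ω ⟨hω, i, hi, hb⟩
      refine ⟨hω, ?_⟩
      rcases i with _ | i
      · exact absurd hb hω.2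
      · exact ⟨i, by omega, by rwa [Nat.succ_add_eq_add_succ]⟩
    · rw [pow_succ]; ring

/-- The probability that each of `u` consecutive blocks of length `r` contains a `true` bit. -/
theorem forall_block_exists_le [IsProbabilityMeasure μ] (h : AdaptedBits μ F b m₁ ε) (hε : ε ≤ 1)
    (hε₀ : 0 ≤ ε) (r u : ℕ) :
    μ.real {ω | ∀ s < u, ∃ i < r, b (m₁ + r * s + i) ω = true} ≤ (1 - (1 - ε) ^ r) ^ u := by
  induction u with
  | zero => simp
  | succ u ih =>
    have hnn : 0 ≤ 1 - (1 - ε) ^ r := by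
      have := pow_le_one₀ (n := r) (by linarith : 0 ≤ 1 - ε) (by linarith)
      linarith
    have hmeas : MeasurableSet[F (m₁ + r * u)]
        {ω | ∀ s < u, ∃ i < r, b (m₁ + r * s + i) ω = true} := by
      simp only [Set.ofPred_forall, Set.ofPred_exists]
      refine MeasurableSet.iInter fun s => MeasurableSet.iInter fun hs =>
        MeasurableSet.iUnion fun i => ?_
      have : {ω | i < r ∧ b (m₁ + r * s + i) ω = true} =
          ⋃ _ : i < r, {ω | b (m₁ + r * s + i) ω = true} := by ext; simp
      rw [this]
      refine MeasurableSet.iUnion fun hi => h.measurableSet_of_lt ?_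
      have : r * (s + 1) ≤ r * u := Nat.mul_le_mul_left r hs
      rw [Nat.mul_succ] at this
      omega
    calc _ ≤ μ.real ({ω | ∀ s < u, ∃ i < r, b (m₁ + r * s + i) ω = true} ∩
          {ω | ∃ i < r, b (m₁ + r * u + i) ω = true}) :=
          measureReal_mono fun ω (hω : ∀ s < u + 1, _) =>
            ⟨fun s hs => hω s (by omega), hω u (by omega)⟩
      _ ≤ (1 - (1 - ε) ^ r) * (1 - (1 - ε) ^ r) ^ u :=
          (h.inter_exists_le hε r (Nat.le_add_right _ _) hmeas).trans
            (mul_le_mul_of_nonneg_left ih hnn)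
      _ = _ := (pow_succ' _ _).symm

end AdaptedBits

/-! ### A race between two kinds of runs -/

/-- One step of a race to a run of `ℓ` equal bits.  The state `(c, r)` says that the last `r` bits
were equal to `c`; it is frozen as soon as `r` has reached `ℓ`. -/
def raceStep (ℓ : ℕ) (z : Bool × ℕ) (c : Bool) : Bool × ℕ :=
  if ℓ ≤ z.2 then z else if c = z.1 then (z.1, z.2 + 1) else (c, 1)

/-- The state of the race that starts from `z` at time `m`, after `n` bits of the sequence `b`. -/
def race (ℓ : ℕ) (z : Bool × ℕ) (m : ℕ) (b : ℕ → Bool) : ℕ → Bool × ℕ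
  | 0 => z
  | n + 1 => raceStep ℓ (race ℓ z m b n) (b (m + n))

theorem race_succ_left (ℓ : ℕ) (z : Bool × ℕ) (m : ℕ) (b : ℕ → Bool) (n : ℕ) :
    race ℓ z m b (n + 1) = race ℓ (raceStep ℓ z (b m)) (m + 1) b n := by
  induction n with
  | zero => rfl
  | succ n ih =>
    rw [race, ih, race, Nat.succ_add_eq_add_succ]

theorem race_frozen {ℓ : ℕ} {z : Bool × ℕ} {m : ℕ} {b : ℕ → Bool} {n n' : ℕ} (hn : n ≤ n')
    (h : ℓ ≤ (race ℓ z m b n).2) : race ℓ z m b n' = race ℓ z m b n := by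
  induction n', hn using Nat.le_induction with
  | base => rfl
  | succ n' _ ih => rw [race, ih, raceStep, if_pos h]

/-- After `r` bits `false` the race is frozen or has a run of at least `r` times `false`. -/
theorem race_of_forall_false {ℓ : ℕ} {z : Bool × ℕ} {m : ℕ} {b : ℕ → Bool} {n r : ℕ}
    (h : ∀ i < r, b (m + n + i) = false) (hr : 0 < r) :
    ℓ ≤ (race ℓ z m b (n + r)).2 ∨
      (race ℓ z m b (n + r)).1 = false ∧ r ≤ (race ℓ z m b (n + r)).2 := by
  induction r, Nat.succ_le_of_lt hr using Nat.le_induction with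
  | base =>
    have h0 := h 0 (by omega)
    rw [Nat.add_zero] at h0
    simp only [race, raceStep, h0]
    split_ifs with h1 h2
    · exact Or.inl h1
    · exact Or.inr ⟨h2.symm, by simp⟩
    · exact Or.inr ⟨rfl, by simp⟩
  | succ r hr' ih =>
    have ih := ih (fun i hi => h i (by omega)) hr'
    have h0 := h r (by omega)
    rw [← Nat.add_assoc, race, ← Nat.add_assoc, h0, raceStep]
    split_ifs with h1 h2
    · exact Or.inl h1
    · have := ih.resolve_left h1
      exact Or.inr ⟨this.1, Nat.succ_le_succ this.2⟩
    · exact absurd (ih.resolve_left h1).1.symm h2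

/-- The probability that a run of `ℓ` bits `true` comes before a run of `ℓ` bits `false`, for
independent bits of which the first is `true` and the others are `true` with probability `ε`. -/
def raceProb (ε : ℝ) (ℓ : ℕ) : ℝ :=
  ε ^ (ℓ - 1) / (1 - (1 - ε ^ (ℓ - 1)) * (1 - (1 - ε) ^ (ℓ - 1)))

/-- The probability that the race is won by `true` when it is in state `z` and the remaining bits
are independent and `true` with probability `ε`.  The truncated subtraction `ℓ - z.2` makes the
value `1` or `0` when the race is over. -/
def raceValue (ε : ℝ) (ℓ : ℕ) (z : Bool × ℕ) : ℝ :=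
  if z.1 then
    ε ^ (ℓ - z.2) + (1 - ε ^ (ℓ - z.2)) * ((1 - (1 - ε) ^ (ℓ - 1)) * raceProb ε ℓ)
  else (1 - (1 - ε) ^ (ℓ - z.2)) * raceProb ε ℓ

section raceValue

variable {ε : ℝ} {ℓ : ℕ}

theorem race_denom_ge (h₀ : 0 < ε) (h₁ : ε < 1) (ℓ : ℕ) :
    (1 - ε) ^ (ℓ - 1) ≤ 1 - (1 - ε ^ (ℓ - 1)) * (1 - (1 - ε) ^ (ℓ - 1)) ∧
      ε ^ (ℓ - 1) ≤ 1 - (1 - ε ^ (ℓ - 1)) * (1 - (1 - ε) ^ (ℓ - 1)) := by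
  have a0 : 0 ≤ ε ^ (ℓ - 1) := by positivity
  have a1 : ε ^ (ℓ - 1) ≤ 1 := pow_le_one₀ h₀.le h₁.le
  have b0 : 0 ≤ (1 - ε) ^ (ℓ - 1) := pow_nonneg (by linarith) _
  have b1 : (1 - ε) ^ (ℓ - 1) ≤ 1 := pow_le_one₀ (by linarith) (by linarith)
  constructor <;> nlinarith

theorem raceProb_nonneg (h₀ : 0 < ε) (h₁ : ε < 1) (ℓ : ℕ) : 0 ≤ raceProb ε ℓ :=
  div_nonneg (by positivity) ((pow_pos h₀ _).le.trans (race_denom_ge h₀ h₁ ℓ).2)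

theorem raceProb_le_one (h₀ : 0 < ε) (h₁ : ε < 1) (ℓ : ℕ) : raceProb ε ℓ ≤ 1 :=
  div_le_one_of_le₀ (race_denom_ge h₀ h₁ ℓ).2 ((pow_pos h₀ _).le.trans (race_denom_ge h₀ h₁ ℓ).2)

theorem raceProb_le (h₀ : 0 < ε) (h₁ : ε < 1) (ℓ : ℕ) :
    raceProb ε ℓ ≤ (ε / (1 - ε)) ^ (ℓ - 1) := by
  rw [raceProb, div_pow]
  exact div_le_div_of_nonneg_left (by positivity) (pow_pos (by linarith) _)
    (race_denom_ge h₀ h₁ ℓ).1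

/-- The equation that defines `raceProb`. -/
theorem raceProb_eq (h₀ : 0 < ε) (h₁ : ε < 1) (ℓ : ℕ) :
    raceProb ε ℓ =
      ε ^ (ℓ - 1) + (1 - ε ^ (ℓ - 1)) * ((1 - (1 - ε) ^ (ℓ - 1)) * raceProb ε ℓ) := by
  have hd : 0 < 1 - (1 - ε ^ (ℓ - 1)) * (1 - (1 - ε) ^ (ℓ - 1)) :=
    (pow_pos h₀ _).trans_le (race_denom_ge h₀ h₁ ℓ).2
  have : raceProb ε ℓ * (1 - (1 - ε ^ (ℓ - 1)) * (1 - (1 - ε) ^ (ℓ - 1))) = ε ^ (ℓ - 1) :=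
    div_mul_cancel₀ _ hd.ne'
  linarith

theorem raceValue_nonneg (h₀ : 0 < ε) (h₁ : ε < 1) (z : Bool × ℕ) : 0 ≤ raceValue ε ℓ z := by
  have hp := raceProb_nonneg h₀ h₁ ℓ
  have hg : ∀ r, 0 ≤ 1 - (1 - ε) ^ r := fun r =>
    sub_nonneg.2 (pow_le_one₀ (by linarith) (by linarith))
  have he : ∀ r, 0 ≤ 1 - ε ^ r := fun r => sub_nonneg.2 (pow_le_one₀ h₀.le h₁.le)
  rw [raceValue]
  split_ifs
  · exact add_nonneg (by positivity) (mul_nonneg (he _) (mul_nonneg (hg _) hp))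
  · exact mul_nonneg (hg _) hp

theorem raceValue_true_of_le {r : ℕ} (hr : ℓ ≤ r) : raceValue ε ℓ (true, r) = 1 := by
  simp [raceValue, Nat.sub_eq_zero_of_le hr]

theorem raceValue_true_zero_le (hℓ : 0 < ℓ) (h₀ : 0 < ε) (h₁ : ε < 1) :
    raceValue ε ℓ (true, 0) ≤ (ε / (1 - ε)) ^ (ℓ - 1) := by
  refine le_trans ?_ (raceProb_le h₀ h₁ ℓ)
  obtain ⟨r, rfl⟩ := Nat.exists_eq_succ_of_ne_zero hℓ.ne'
  have heq := raceProb_eq h₀ h₁ (r + 1)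
  have hp := raceProb_nonneg h₀ h₁ (r + 1)
  have hp1 := raceProb_le_one h₀ h₁ (r + 1)
  have a0 : 0 ≤ ε ^ r := by positivity
  have b0 : 0 ≤ (1 - ε) ^ r := pow_nonneg (by linarith) _
  have b1 : (1 - ε) ^ r ≤ 1 := pow_le_one₀ (by linarith) (by linarith)
  simp only [raceValue, if_true, Nat.add_sub_cancel, Nat.sub_zero, Nat.succ_eq_add_one,
    pow_succ] at heq ⊢
  have hw : (1 - (1 - ε) ^ r) * raceProb ε (r + 1) ≤ 1 := mul_le_one₀ (by linarith) hp hp1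
  nlinarith [mul_nonneg a0 (sub_nonneg.2 h₁.le), mul_nonneg (mul_nonneg a0 (sub_nonneg.2 h₁.le))
    (sub_nonneg.2 hw)]

theorem raceValue_step_mono (h₀ : 0 < ε) (h₁ : ε < 1) (z : Bool × ℕ) :
    raceValue ε ℓ (raceStep ℓ z false) ≤ raceValue ε ℓ (raceStep ℓ z true) := by
  obtain ⟨c, r⟩ := z
  have hp := raceProb_nonneg h₀ h₁ ℓ
  have hp1 := raceProb_le_one h₀ h₁ ℓ
  have heq := raceProb_eq h₀ h₁ ℓ
  have hg0 : ∀ r, 0 ≤ (1 - ε) ^ r := fun r => pow_nonneg (by linarith) _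
  have hg : ∀ r, (1 - ε) ^ r ≤ 1 := fun r => pow_le_one₀ (by linarith) (by linarith)
  by_cases hr : ℓ ≤ r
  · simp [raceStep, hr]
  cases c
  · simp only [raceStep, hr, if_false, if_true, raceValue, Bool.true_eq_false, Bool.false_eq_true]
    nlinarith [hg0 (ℓ - (r + 1))]
  · simp only [raceStep, hr, if_false, if_true, raceValue, Bool.false_eq_true]
    have hw : (1 - (1 - ε) ^ (ℓ - 1)) * raceProb ε ℓ ≤ 1 :=
      mul_le_one₀ (by linarith [hg0 (ℓ - 1)]) hp hp1
    have : 0 ≤ ε ^ (ℓ - (r + 1)) := by positivity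
    nlinarith

/-- `raceValue` is harmonic for independent bits that are `true` with probability `ε`. -/
theorem raceValue_step (h₀ : 0 < ε) (h₁ : ε < 1) (z : Bool × ℕ) :
    ε * raceValue ε ℓ (raceStep ℓ z true) + (1 - ε) * raceValue ε ℓ (raceStep ℓ z false) =
      raceValue ε ℓ z := by
  obtain ⟨c, r⟩ := z
  by_cases hr : ℓ ≤ r
  · simp only [raceStep, hr, if_true]
    ring
  have hs : ℓ - r = ℓ - (r + 1) + 1 := by omega
  have heq := raceProb_eq h₀ h₁ ℓ
  cases c
  · simp only [raceStep, hr, if_false, if_true, raceValue, Bool.true_eq_false, Bool.false_eq_true]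
    rw [← heq, hs, pow_succ]
    ring
  · simp only [raceStep, hr, if_false, if_true, raceValue, Bool.false_eq_true]
    rw [hs, pow_succ]
    ring

end raceValue

namespace AdaptedBits

variable {Ω : Type*} {mΩ : MeasurableSpace Ω} {μ : Measure Ω} [IsFiniteMeasure μ]
  {F : Filtration ℕ mΩ} {b : ℕ → Ω → Bool} {m₁ : ℕ} {ε : ℝ}

/-- The supermartingale property of `raceValue`, as a bound on every event `A` of the past. -/
theorem inter_race_le (h : AdaptedBits μ F b m₁ ε) (h₀ : 0 < ε) (h₁ : ε < 1) (ℓ n : ℕ) :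
    ∀ {m : ℕ}, m₁ ≤ m → ∀ (z : Bool × ℕ) {A : Set Ω}, MeasurableSet[F m] A →
      μ.real (A ∩ {ω | (race ℓ z m (b · ω) n).1 = true ∧ ℓ ≤ (race ℓ z m (b · ω) n).2}) ≤
        raceValue ε ℓ z * μ.real A := by
  induction n with
  | zero =>
    intro m _ z A _
    simp only [race]
    by_cases hz : z.1 = true ∧ ℓ ≤ z.2
    · rw [show z = (true, z.2) from Prod.ext hz.1 rfl, raceValue_true_of_le hz.2, one_mul]
      exact measureReal_mono Set.inter_subset_left
    · simp only [hz, Set.ofPred_false, Set.inter_empty, measureReal_empty]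
      exact mul_nonneg (raceValue_nonneg h₀ h₁ z) measureReal_nonneg
  | succ n ih =>
    intro m hm z A hA
    simp only [race_succ_left]
    rw [← raceValue_step h₀ h₁ z]
    refine h.inter_le hm hA (raceValue_step_mono h₀ h₁ z) ?_ ?_
    · refine (measureReal_mono ?_).trans (ih (hm.trans m.le_succ) _ (h.inter_measurable hA))
      rintro ω ⟨hω, hE⟩
      have hb : b m ω = true := hω.2
      rw [Set.mem_ofPred_eq, hb] at hE
      exact ⟨hω, hE⟩
    · refine (measureReal_mono ?_).trans (ih (hm.trans m.le_succ) _ (h.diff_measurable hA))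
      rintro ω ⟨hω, hE⟩
      have hb : b m ω = false := Bool.eq_false_iff.2 hω.2
      rw [Set.mem_ofPred_eq, hb] at hE
      exact ⟨hω, hE⟩

/-- A run of `ℓ` bits `true` comes before a run of `ℓ` bits `false` with probability at most
`(ε / (1 - ε)) ^ (ℓ - 1)`. -/
theorem race_le [IsProbabilityMeasure μ] (h : AdaptedBits μ F b m₁ ε) (h₀ : 0 < ε) (h₁ : ε < 1)
    {ℓ : ℕ} (hℓ : 0 < ℓ) (n : ℕ) :
    μ.real {ω | (race ℓ (true, 0) m₁ (b · ω) n).1 = true ∧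
        ℓ ≤ (race ℓ (true, 0) m₁ (b · ω) n).2} ≤ (ε / (1 - ε)) ^ (ℓ - 1) := by
  have := h.inter_race_le h₀ h₁ ℓ n le_rfl (true, 0) (A := Set.univ) MeasurableSet.univ
  rw [Set.univ_inter, probReal_univ, mul_one] at this
  exact this.trans (raceValue_true_zero_le hℓ h₀ h₁)

end AdaptedBits

namespace FPCParams

/-! ### The past of a round -/

section Past

variable {p : FPCParams} {S : Type*} [MeasurableSpace S]

/-- The events that depend on the private randomness of the adversary and on the first `m` rounds
only. -/
def past (p : FPCParams) (S : Type*) [MeasurableSpace S] :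
    Filtration ℕ (inferInstance : MeasurableSpace (S × p.Path)) where
  seq m := MeasurableSpace.comap
    (fun ω : S × p.Path => (ω.1, fun i : Fin m => ω.2 i)) inferInstance
  mono' := by
    intro m m' h
    dsimp only
    have hf : Measurable fun y : S × (Fin m' → p.Round) =>
        (y.1, fun i : Fin m => y.2 (Fin.castLE h i)) := by fun_prop
    rw [show (fun ω : S × p.Path => (ω.1, fun i : Fin m => ω.2 i)) =
      (fun y : S × (Fin m' → p.Round) => (y.1, fun i : Fin m => y.2 (Fin.castLE h i))) ∘
        fun ω : S × p.Path => (ω.1, fun i : Fin m' => ω.2 i) from rfl,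
      ← MeasurableSpace.comap_comp]
    exact MeasurableSpace.comap_mono hf.comap_le
  le' m := Measurable.comap_le (by fun_prop)

theorem measurable_past (m : ℕ) : Measurable[p.past S m]
    fun ω : S × p.Path => (ω.1, fun i : Fin m => ω.2 i) :=
  comap_measurable _

theorem indepFun_restrict_eval (m : ℕ) :
    IndepFun (fun (y : p.Path) (i : Fin m) => y i) (fun y : p.Path => y m) p.pathLaw := by
  have h : iIndepFun (fun (i : ℕ) (y : p.Path) => y i) p.pathLaw :=
    iIndepFun_infinitePi (X := fun _ y => y) fun _ => measurable_id
  have h' := h.indepFun_finset (Finset.range m) {m} (by simp) fun i => measurable_pi_apply i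
  have hφ : Measurable fun (z : Finset.range m → p.Round) (i : Fin m) =>
      z ⟨i, Finset.mem_range.2 i.2⟩ := by fun_prop
  have hψ : Measurable fun z : ({m} : Finset ℕ) → p.Round => z ⟨m, Finset.mem_singleton_self m⟩ :=
    measurable_pi_apply _
  exact h'.comp hφ hψ

theorem map_eval_pathLaw (m : ℕ) :
    p.pathLaw.map (fun y => y m) = p.queriesLaw.prod (p.thresholdLaw m) :=
  Measure.infinitePi_map_eval _ m

theorem pathLaw_real_queries (m : ℕ) (C : Set p.Queries) :
    p.pathLaw.real {y | (y m).1 ∈ C} = p.queriesLaw.real C := by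
  have hC : MeasurableSet C := C.toFinite.measurableSet
  have h : (p.pathLaw.map fun y => y m).map Prod.fst = p.queriesLaw := by
    rw [map_eval_pathLaw, Measure.map_fst_prod]
    simp
  conv_rhs => rw [← h]
  rw [map_measureReal_apply measurable_fst hC,
    map_measureReal_apply (measurable_pi_apply m) (measurable_fst hC)]
  rfl

variable (σ : Measure S)

/-- The queries of a round are independent of the past. -/
theorem real_inter_queries {m : ℕ} {A : Set (S × p.Path)} (hA : MeasurableSet[p.past S m] A)
    (C : Set p.Queries) :
    (σ.prod p.pathLaw).real (A ∩ {ω | (ω.2 m).1 ∈ C}) =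
      p.queriesLaw.real C * (σ.prod p.pathLaw).real A := by
  have hC : MeasurableSet C := C.toFinite.measurableSet
  obtain ⟨A', hA', rfl⟩ := hA
  have hf : Measurable fun ω : S × p.Path => (ω.1, fun i : Fin m => ω.2 i) := by fun_prop
  have hg : Measurable fun ω : S × p.Path => (ω.2 m).1 := by fun_prop
  have hB : MeasurableSet {ω : S × p.Path | (ω.2 m).1 ∈ C} := hg hC
  have key : (σ.prod p.pathLaw) ((fun ω : S × p.Path => (ω.1, fun i : Fin m => ω.2 i)) ⁻¹' A' ∩
      {ω | (ω.2 m).1 ∈ C}) = p.pathLaw {y | (y m).1 ∈ C} *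
        (σ.prod p.pathLaw) ((fun ω : S × p.Path => (ω.1, fun i : Fin m => ω.2 i)) ⁻¹' A') := by
    rw [Measure.prod_apply ((hf hA').inter hB), Measure.prod_apply (hf hA'),
      ← lintegral_const_mul _ (measurable_measure_prodMk_left (hf hA'))]
    refine lintegral_congr fun s => ?_
    rw [mul_comm]
    exact (indepFun_restrict_eval m).measure_inter_preimage_eq_mul
      {z | (s, z) ∈ A'} {z | z.1 ∈ C} (measurable_prodMk_left hA') (measurable_fst hC)
  rw [measureReal_def, key, ENNReal.toReal_mul, ← pathLaw_real_queries m C]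
  rfl

variable [IsProbabilityMeasure σ]

/-- A bound on the probability of events of the current queries is a bound on the conditional
probability if the event is selected according to the past. -/
theorem real_inter_queries_le {m : ℕ} {A : Set (S × p.Path)} (hA : MeasurableSet[p.past S m] A)
    {T : Type*} [Finite T] {d : S × p.Path → T}
    (hd : ∀ x, MeasurableSet[p.past S m] (d ⁻¹' {x})) {C : T → Set p.Queries} {c : ℝ}
    (hC : ∀ x, p.queriesLaw.real (C x) ≤ c) :
    (σ.prod p.pathLaw).real (A ∩ {ω | (ω.2 m).1 ∈ C (d ω)}) ≤
      c * (σ.prod p.pathLaw).real A := by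
  have := Fintype.ofFinite T
  have hsum : ∑ x, (σ.prod p.pathLaw).real (A ∩ d ⁻¹' {x}) = (σ.prod p.pathLaw).real A := by
    have h := sum_measureReal_preimage_singleton (μ := (σ.prod p.pathLaw).restrict A)
      (Finset.univ : Finset T) (f := d) fun x _ => (p.past S).le m _ (hd x)
    simp only [Finset.coe_univ, Set.preimage_univ, measureReal_restrict_apply_univ] at h
    rw [← h]
    refine Finset.sum_congr rfl fun x _ => ?_
    rw [measureReal_restrict_apply ((p.past S).le m _ (hd x)), Set.inter_comm]
  rw [← hsum, Finset.mul_sum]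
  refine (measureReal_mono (s₂ := ⋃ x, (A ∩ d ⁻¹' {x}) ∩ {ω | (ω.2 m).1 ∈ C x}) ?_).trans
    ((measureReal_iUnion_fintype_le _).trans (Finset.sum_le_sum fun x _ => ?_))
  · rintro ω ⟨hω, hQ⟩
    exact Set.mem_iUnion.2 ⟨d ω, ⟨hω, rfl⟩, hQ⟩
  · rw [real_inter_queries σ (hA.inter (hd x))]
    exact mul_le_mul_of_nonneg_right (hC x) measureReal_nonneg

end Past

/-! ### Measurability of the state -/

section Measurability

variable {p : FPCParams} {S : Type*} [MeasurableSpace S]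

theorem measurable_step {α : Type*} [MeasurableSpace α] (m : ℕ) {s : α → State p}
    {Q : α → p.Queries} {x : α → ℝ} {r : α → p.Replies}
    (hs : ∀ j, Measurable fun y => (s y).opinion j) (hs' : ∀ j, Measurable fun y => (s y).streak j)
    (hQ : Measurable Q) (hx : Measurable x) (hr : Measurable r) (j : p.Honest) :
    (Measurable fun y => (step m (s y) (Q y) (x y) (r y)).opinion j) ∧
      Measurable fun y => (step m (s y) (Q y) (x y) (r y)).streak j := by
  have heta : Measurable fun y => (eta (s y).opinion (Q y) (r y) j : ℝ) / p.k := by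
    have h : Measurable fun z : (p.Honest → Bool) × p.Queries × p.Replies =>
        eta z.1 z.2.1 z.2.2 j := measurable_of_countable _
    have hop : Measurable fun y => (s y).opinion := measurable_pi_lambda _ hs
    have hpair : Measurable fun y => ((s y).opinion, Q y, r y) := hop.prodMk (hQ.prodMk hr)
    have hη : Measurable fun y => eta (s y).opinion (Q y) (r y) j := h.comp hpair
    exact (measurable_of_countable (Nat.cast : ℕ → ℝ)).comp hη |>.div_const _
  have hdec : Measurable fun y => decide (x y ≤ (eta (s y).opinion (Q y) (r y) j : ℝ) / p.k) := by
    refine measurable_to_bool ?_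
    convert measurableSet_le hx heta using 1
    ext y
    simp
  have hnew : Measurable fun y => (step m (s y) (Q y) (x y) (r y)).opinion j :=
    Measurable.ite (measurableSet_le measurable_const (hs' j)) (hs j) hdec
  refine ⟨hnew, ?_⟩
  refine Measurable.ite (MeasurableSet.const _) measurable_const ?_
  exact Measurable.ite (measurableSet_eq_fun hnew (hs j)) ((hs' j).add_const 1) measurable_const

theorem measurable_state (ξ₀ : p.Honest → Bool) (A : p.Strategy S) (m : ℕ) :
    ∀ j, Measurable[p.past S m] (fun ω => (state ξ₀ A ω m).opinion j) ∧
      Measurable[p.past S m] (fun ω => (state ξ₀ A ω m).streak j) := by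
  induction m with
  | zero => exact fun j => ⟨measurable_const, measurable_const⟩
  | succ m ih =>
    intro j
    have hmono := (p.past S).mono m.le_succ
    have hQ : Measurable[p.past S (m + 1)] fun ω : S × p.Path => (ω.2 m).1 :=
      Measurable.comp (g := fun z : S × (Fin (m + 1) → p.Round) => (z.2 (Fin.last m)).1)
        (by fun_prop) (measurable_past (m + 1))
    have hx : Measurable[p.past S (m + 1)] fun ω : S × p.Path => (ω.2 m).2 :=
      Measurable.comp (g := fun z : S × (Fin (m + 1) → p.Round) => (z.2 (Fin.last m)).2)
        (by fun_prop) (measurable_past (m + 1))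
    have hr : Measurable[p.past S (m + 1)] fun ω : S × p.Path =>
        A.reply m (ω.1, (fun i : Fin m => ω.2 i), (ω.2 m).1) :=
      Measurable.comp (g := fun z : S × (Fin (m + 1) → p.Round) =>
          A.reply m (z.1, (fun i : Fin m => z.2 i.castSucc), (z.2 (Fin.last m)).1))
        ((A.measurable_reply m).comp (by fun_prop)) (measurable_past (m + 1))
    exact @measurable_step p (S × p.Path) (p.past S (m + 1)) m _ _ _ _
      (fun j => (ih j).1.mono hmono le_rfl) (fun j => (ih j).2.mono hmono le_rfl) hQ hx hr j

theorem measurable_opinion (ξ₀ : p.Honest → Bool) (A : p.Strategy S) (m : ℕ) :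
    Measurable[p.past S m] fun ω => opinion ξ₀ A ω m :=
  @measurable_pi_lambda _ _ _ (p.past S m) _ _ fun j => (measurable_state ξ₀ A m j).1

end Measurability

/-! ### Nodes that may contradict the target opinion -/

section Contrary

variable {p : FPCParams}

/-- The nodes whose answer may differ from the target opinion `t`: the adversarial ones and the
honest ones with another opinion. -/
def contrary (t : Bool) (op : p.Honest → Bool) : Finset p.Node :=
  Finset.univ.filter fun v => ∀ h : (v : ℕ) < p.numHonest, op ⟨v, h⟩ ≠ t

theorem card_contrary (t : Bool) (op : p.Honest → Bool) :
    ((contrary t op).card : ℝ) =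
      p.n - p.numHonest + ((Finset.univ.filter fun j => op j ≠ t).card : ℝ) := by
  have hcompl : (contrary t op)ᶜ =
      (Finset.univ.filter fun j => op j = t).map (Fin.castLEEmb p.numHonest_le) := by
    ext v
    simp only [contrary, Finset.mem_compl, Finset.mem_filter, Finset.mem_univ, true_and, not_forall,
      not_not, Finset.mem_map, Fin.castLEEmb_apply]
    constructor
    · rintro ⟨h, h'⟩
      exact ⟨⟨v, h⟩, h', rfl⟩
    · rintro ⟨j, hj, rfl⟩
      exact ⟨j.2, hj⟩
  have h1 := Finset.card_add_card_compl (contrary t op)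
  rw [hcompl, Finset.card_map, Fintype.card_fin] at h1
  have h2 := Finset.card_filter_add_card_filter_not (s := (Finset.univ : Finset p.Honest))
    (fun j => op j = t)
  rw [Finset.card_univ, Fintype.card_fin] at h2
  have h1' : ((contrary t op).card : ℝ) + ((Finset.univ.filter fun j => op j = t).card : ℝ) =
    p.n := by exact_mod_cast h1
  have h2' : ((Finset.univ.filter fun j => op j = t).card : ℝ) +
    ((Finset.univ.filter fun j => op j ≠ t).card : ℝ) = p.numHonest := by exact_mod_cast h2
  linarith

/-- The number of the queries `Q` of a node that are addressed to nodes in `D`. -/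
def hits (D : Finset p.Node) (Q : Fin p.k → p.Node) : ℕ :=
  (Finset.univ.filter fun i => Q i ∈ D).card

/-- The thresholds `x` for which a node needs a proportion `c` of answers other than `t` to
adopt another opinion than `t`. -/
def Protects (t : Bool) (c x : ℝ) : Prop :=
  if t then x ≤ 1 - c else c ≤ x

/-- Whatever the replies of the adversary are, a node whose opinion is not `t` after a round has hit
many contrary nodes, unless another opinion than `t` was final before. -/
theorem hits_ge_of_step_opinion_ne {t : Bool} {c x : ℝ} (hx : Protects t c x) {m : ℕ} {s : State p}
    {Q : p.Queries} {r : p.Replies} {j : p.Honest} (hs : s.opinion j ≠ t → s.streak j < p.ℓ)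
    (h : (step m s Q x r).opinion j ≠ t) : c * p.k ≤ hits (contrary t s.opinion) (Q j) := by
  have hk : 0 < (p.k : ℝ) := by exact_mod_cast p.k_pos
  have hle : (Finset.univ.filter fun i => answer s.opinion (Q j i) (r j i) ≠ t).card ≤
      hits (contrary t s.opinion) (Q j) := by
    refine Finset.card_le_card fun i hi => ?_
    simp only [Finset.mem_filter, Finset.mem_univ, true_and, contrary] at hi ⊢
    intro hv
    rwa [answer, dif_pos hv] at hi
  refine le_trans ?_ (Nat.cast_le (α := ℝ).2 hle)
  by_cases hfin : p.ℓ ≤ s.streak j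
  · have : (step m s Q x r).opinion j = s.opinion j := if_pos hfin
    rw [this] at h
    exact absurd hfin (not_le.2 (hs h))
  have hnew : (step m s Q x r).opinion j = decide (x ≤ (eta s.opinion Q r j : ℝ) / p.k) :=
    if_neg hfin
  rw [hnew] at h
  cases t
  · simp only [Protects, Bool.false_eq_true, if_false] at hx
    simp only [ne_eq, decide_eq_false_iff_not, not_not, le_div_iff₀ hk] at h
    simp only [ne_eq, Bool.not_eq_false]
    exact (mul_le_mul_of_nonneg_right hx hk.le).trans h
  · simp only [Protects, if_true] at hx
    simp only [ne_eq, decide_eq_true_eq, not_le, div_lt_iff₀ hk] at h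
    have hsum := Finset.card_filter_add_card_filter_not (s := (Finset.univ : Finset (Fin p.k)))
      (fun i => answer s.opinion (Q j i) (r j i) = true)
    rw [Finset.card_univ, Fintype.card_fin] at hsum
    have hsum' : (eta s.opinion Q r j : ℝ) +
      ((Finset.univ.filter fun i => answer s.opinion (Q j i) (r j i) ≠ true).card : ℝ) = p.k := by
      exact_mod_cast hsum
    nlinarith

variable (p)

/-- `e^{-k(β-q)²/2}`, a bound on the probability that a node receives many answers other than the
target opinion. -/
def eps : ℝ := Real.exp (-(1 / 2) * p.k * (p.β - p.q) ^ 2)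

/-- The proportion of honest nodes with the wrong opinion that is not exceeded in a good round. -/
def rho : ℝ := (p.β - p.q) / (2 * (1 - p.q))

theorem phi_eq : p.phi = p.rho - p.eps := rfl

theorem n_pos : 0 < (p.n : ℝ) := by
  exact_mod_cast p.numHonest_pos.trans_le p.numHonest_le

theorem numHonest_pos_real : 0 < (p.numHonest : ℝ) := by
  exact_mod_cast p.numHonest_pos

theorem q_mul_n : p.q * p.n = p.n - p.numHonest :=
  div_mul_cancel₀ _ p.n_pos.ne'

theorem one_sub_q_mul_n : (1 - p.q) * p.n = p.numHonest := by
  linarith [p.q_mul_n]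

theorem one_sub_q_pos : 0 < 1 - p.q :=
  pos_of_mul_pos_left (p.one_sub_q_mul_n ▸ p.numHonest_pos_real) p.n_pos.le

theorem q_nonneg : 0 ≤ p.q :=
  div_nonneg (sub_nonneg.2 (by exact_mod_cast p.numHonest_le)) p.n_pos.le

theorem rho_mul_numHonest : p.rho * p.numHonest = p.n * (p.β - p.q) / 2 := by
  have := p.one_sub_q_pos.ne'
  rw [← p.one_sub_q_mul_n, rho]
  field_simp

theorem eps_pos : 0 < p.eps := Real.exp_pos _

theorem eps_lt_one (hφ : 0 < p.phi) : p.eps < 1 := by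
  have h1 : p.rho < 1 := by
    have := p.β_lt_half
    rw [rho, div_lt_one (by linarith [p.one_sub_q_pos])]
    linarith [p.one_sub_q_pos]
  rw [phi_eq] at hφ
  linarith

variable {p}

theorem uniformOn_real (D : Finset p.Node) :
    (uniformOn (Set.univ : Set p.Node)).real {v | v ∈ D} = D.card / p.n := by
  rw [measureReal_def, uniformOn_univ, show {v | v ∈ D} = (D : Set p.Node) from rfl,
    Measure.count_apply_finset]
  simp [ENNReal.toReal_div]

/-- A node that queries uniformly chosen nodes hits a set with a proportion `x` of the nodes
rarely with a proportion `x + t` of the queries. -/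
theorem real_hits_ge_le {D : Finset p.Node} {x t : ℝ} (hD : (D.card : ℝ) ≤ x * p.n) (ht : 0 ≤ t) :
    (Measure.pi fun _ : Fin p.k => uniformOn (Set.univ : Set p.Node)).real
      {Q | (x + t) * p.k ≤ hits D Q} ≤ Real.exp (-2 * p.k * t ^ 2) := by
  have h := measureReal_pi_count_ge_le (ι := Fin p.k) (uniformOn (Set.univ : Set p.Node))
    (C := {v | v ∈ D}) (Set.toFinite _).measurableSet (x := x) (t := t)
    (by rwa [uniformOn_real, div_le_iff₀ p.n_pos]) ht
  rw [Fintype.card_fin] at h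
  exact h

/-- The honest nodes that hit `D` with at least a proportion `c` of their queries. -/
def misled (D : Finset p.Node) (c : ℝ) (Q : p.Queries) : Finset p.Honest :=
  Finset.univ.filter fun j => c * p.k ≤ hits D (Q j)

theorem real_misled_le {D : Finset p.Node} {c y t : ℝ}
    (hy : (Measure.pi fun _ : Fin p.k => uniformOn (Set.univ : Set p.Node)).real
      {Q | c * p.k ≤ hits D Q} ≤ y) (ht : 0 ≤ t) :
    p.queriesLaw.real {Q | (y + t) * p.numHonest ≤ (misled D c Q).card} ≤
      Real.exp (-2 * p.numHonest * t ^ 2) := by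
  classical
  have h := measureReal_pi_count_ge_le (ι := p.Honest)
    (Measure.pi fun _ : Fin p.k => uniformOn (Set.univ : Set p.Node))
    (C := {Q | c * p.k ≤ hits D Q}) (Set.toFinite _).measurableSet hy ht
  rw [Fintype.card_fin] at h
  refine le_trans (le_of_eq ?_) h
  simp only [misled, queriesLaw, Set.mem_ofPred_eq]

theorem real_mem_misled (D : Finset p.Node) (c : ℝ) (j : p.Honest) :
    p.queriesLaw.real {Q | j ∈ misled D c Q} =
      (Measure.pi fun _ : Fin p.k => uniformOn (Set.univ : Set p.Node)).real
        {Q | c * p.k ≤ hits D Q} := by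
  have h := (measurePreserving_eval
    (fun _ : p.Honest => Measure.pi fun _ : Fin p.k => uniformOn (Set.univ : Set p.Node))
    j).measureReal_preimage (s := {Q | c * p.k ≤ hits D Q})
    (Set.toFinite _).measurableSet.nullMeasurableSet
  rw [← h]
  simp only [misled, Finset.mem_filter, Finset.mem_univ, true_and]
  rfl

end Contrary
/-! ### Truncated suspects and misled nodes -/

section Suspects

variable {p : FPCParams} {S : Type*} [MeasurableSpace S]

/-- The nodes that may contradict the target opinion `t` after round `m`, replaced by the empty set
when there are too many of them.  The truncation makes the conditional probability of being misled
small whatever happened before; on the good event it is not active. -/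
def suspects (t : Bool) (ξ₀ : p.Honest → Bool) (A : p.Strategy S) (m : ℕ) (ω : S × p.Path) :
    Finset p.Node :=
  if ((contrary t (opinion ξ₀ A ω m)).card : ℝ) ≤ (p.β + p.q) / 2 * p.n then
    contrary t (opinion ξ₀ A ω m) else ∅

theorem card_suspects_le (t : Bool) (ξ₀ : p.Honest → Bool) (A : p.Strategy S) (m : ℕ)
    (ω : S × p.Path) : ((suspects t ξ₀ A m ω).card : ℝ) ≤ (p.β + p.q) / 2 * p.n := by
  rw [suspects]
  split_ifs with h
  · exact h
  · have := p.β_pos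
    have := p.q_nonneg
    have := p.n_pos
    simp only [Finset.card_empty, Nat.cast_zero]
    positivity

theorem measurableSet_suspects (t : Bool) (ξ₀ : p.Honest → Bool) (A : p.Strategy S) (m : ℕ)
    (E : Set (Finset p.Node)) : MeasurableSet[p.past S m] (suspects t ξ₀ A m ⁻¹' E) := by
  have h : MeasurableSet {op : p.Honest → Bool |
      (if ((contrary t op).card : ℝ) ≤ (p.β + p.q) / 2 * p.n then contrary t op else ∅) ∈ E} :=
    (Set.toFinite _).measurableSet
  exact measurable_opinion ξ₀ A m h

/-- The bits that say whether the honest node `j` hits the suspects in round `m + 1` with at least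
a proportion `β` of its queries. -/
def misledBit (t : Bool) (ξ₀ : p.Honest → Bool) (A : p.Strategy S) (j : p.Honest) (m : ℕ)
    (ω : S × p.Path) : Bool :=
  decide (j ∈ misled (suspects t ξ₀ A m ω) p.β (ω.2 m).1)

/-- When few nodes are suspect, a node is misled with probability at most `eps`. -/
theorem real_hits_β_le (hq : p.q ≤ p.β) {D : Finset p.Node}
    (hD : (D.card : ℝ) ≤ (p.β + p.q) / 2 * p.n) :
    (Measure.pi fun _ : Fin p.k => uniformOn (Set.univ : Set p.Node)).real
      {Q | p.β * p.k ≤ hits D Q} ≤ p.eps := by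
  have h := real_hits_ge_le (t := (p.β - p.q) / 2) hD (by linarith)
  rw [show (p.β + p.q) / 2 + (p.β - p.q) / 2 = p.β by ring] at h
  refine h.trans (le_of_eq ?_)
  rw [eps]
  congr 1
  ring

variable (σ : Measure S) [IsProbabilityMeasure σ]

theorem real_inter_suspects_le {m : ℕ} {A' : Set (S × p.Path)}
    (hA' : MeasurableSet[p.past S m] A') (t : Bool) (ξ₀ : p.Honest → Bool) (A : p.Strategy S)
    {C : Finset p.Node → Set p.Queries} {c : ℝ}
    (hC : ∀ D : Finset p.Node, (D.card : ℝ) ≤ (p.β + p.q) / 2 * p.n → p.queriesLaw.real (C D) ≤ c) :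
    (σ.prod p.pathLaw).real (A' ∩ {ω | (ω.2 m).1 ∈ C (suspects t ξ₀ A m ω)}) ≤
      c * (σ.prod p.pathLaw).real A' := by
  let d : S × p.Path → {D : Finset p.Node // (D.card : ℝ) ≤ (p.β + p.q) / 2 * p.n} :=
    fun ω => ⟨suspects t ξ₀ A m ω, card_suspects_le t ξ₀ A m ω⟩
  refine real_inter_queries_le σ hA' (d := d) (fun x => ?_) (C := fun D => C D.1)
    fun D => hC D.1 D.2
  convert measurableSet_suspects t ξ₀ A m {x.1} using 1
  ext ω
  simp [d, Subtype.ext_iff]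

theorem adaptedBits_misledBit (hq : p.q ≤ p.β) (t : Bool) (ξ₀ : p.Honest → Bool)
    (A : p.Strategy S) (j : p.Honest) (m₁ : ℕ) :
    AdaptedBits (σ.prod p.pathLaw) (p.past S) (misledBit t ξ₀ A j) m₁ p.eps where
  measurableSet m := by
    have hQ : Measurable[p.past S (m + 1)] fun ω : S × p.Path => (ω.2 m).1 :=
      Measurable.comp (g := fun z : S × (Fin (m + 1) → p.Round) => (z.2 (Fin.last m)).1)
        (by fun_prop) (measurable_past (m + 1))
    have hunion : {ω | misledBit t ξ₀ A j m ω = true} =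
        ⋃ Q : p.Queries, suspects t ξ₀ A m ⁻¹' {D | j ∈ misled D p.β Q} ∩
          (fun ω : S × p.Path => (ω.2 m).1) ⁻¹' {Q} := by
      ext ω
      simp [misledBit]
    rw [hunion]
    exact MeasurableSet.iUnion fun Q =>
      ((p.past S).mono m.le_succ _ (measurableSet_suspects t ξ₀ A m _)).inter
        (hQ (Set.toFinite {Q}).measurableSet)
  le m _ A' hA' := by
    simp only [misledBit, decide_eq_true_eq]
    refine real_inter_suspects_le σ hA' t ξ₀ A (C := fun D => {Q | j ∈ misled D p.β Q})
      fun D hD => ?_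
    rw [real_mem_misled]
    exact real_hits_β_le hq hD

/-- It is unlikely that a proportion `rho` of the honest nodes is misled in one round. -/
theorem real_card_misled_le (hq : p.q ≤ p.β) (hφ : 0 ≤ p.phi) (t : Bool) (ξ₀ : p.Honest → Bool)
    (A : p.Strategy S) (m : ℕ) :
    (σ.prod p.pathLaw).real
        {ω | p.rho * p.numHonest ≤ (misled (suspects t ξ₀ A m ω) p.β (ω.2 m).1).card} ≤
      Real.exp (-2 * p.numHonest * p.phi ^ 2) := by
  have h := real_inter_suspects_le σ (m := m) (A' := Set.univ) MeasurableSet.univ t ξ₀ A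
    (C := fun D => {Q | (p.eps + p.phi) * p.numHonest ≤ (misled D p.β Q).card})
    fun D hD => real_misled_le (real_hits_β_le hq hD) hφ
  rw [Set.univ_inter, probReal_univ, mul_one, show p.eps + p.phi = p.rho by rw [phi_eq]; ring] at h
  exact h

end Suspects

/-! ### The good event -/

section Good

variable {p : FPCParams} {S : Type*} [MeasurableSpace S]

/-- The events on which consensus on `t` is reached: the thresholds lie in their intervals, few
honest nodes are misled in each round, and the bits of each honest node contain a block of length
`ℓ` of bits `false`, but no run of `ℓ` bits `true` before the first run of `ℓ` bits `false`.
`c₀` is the proportion of contrary answers that a node needs to be misled in the first round. -/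
structure Good (t : Bool) (c₀ : ℝ) (ξ₀ : p.Honest → Bool) (A : p.Strategy S) (u : ℕ)
    (ω : S × p.Path) : Prop where
  threshold_zero : Protects t c₀ (ω.2 0).2
  threshold : ∀ m, m ≠ 0 → Protects t p.β (ω.2 m).2
  misled_zero : ((misled (contrary t ξ₀) c₀ (ω.2 0).1).card : ℝ) < p.rho * p.numHonest
  misled : ∀ m < p.m₀ + p.ℓ * u,
    ((misled (suspects t ξ₀ A m ω) p.β (ω.2 m).1).card : ℝ) < p.rho * p.numHonest
  race : ∀ j, ¬((race p.ℓ (true, 0) p.m₀ (misledBit t ξ₀ A j · ω) (p.ℓ * u)).1 = true ∧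
    p.ℓ ≤ (race p.ℓ (true, 0) p.m₀ (misledBit t ξ₀ A j · ω) (p.ℓ * u)).2)
  block : ∀ j, ∃ s < u, ∀ i < p.ℓ, misledBit t ξ₀ A j (p.m₀ + p.ℓ * s + i) ω = false

theorem hits_ge_of_opinion_ne {t : Bool} {c : ℝ} {ξ₀ : p.Honest → Bool} {A : p.Strategy S}
    {ω : S × p.Path} {m : ℕ} (hx : Protects t c (ω.2 m).2) {j : p.Honest}
    (hfin : opinion ξ₀ A ω m j ≠ t → (state ξ₀ A ω m).streak j < p.ℓ)
    (hj : opinion ξ₀ A ω (m + 1) j ≠ t) :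
    c * p.k ≤ hits (contrary t (opinion ξ₀ A ω m)) ((ω.2 m).1 j) :=
  hits_ge_of_step_opinion_ne (s := state ξ₀ A ω m) (m := m) (Q := (ω.2 m).1)
    (r := A.reply m (ω.1, (fun i : Fin m => ω.2 i), (ω.2 m).1)) hx hfin hj

namespace Good

variable {t : Bool} {c₀ : ℝ} {ξ₀ : p.Honest → Bool} {A : p.Strategy S} {u : ℕ} {ω : S × p.Path}

/-- One step of the induction: every honest node with the wrong opinion has just been misled. -/
theorem card_contrary_succ (h : Good t c₀ ξ₀ A u ω) {m : ℕ} (hm : m < p.m₀ + p.ℓ * u)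
    (hcard : m ≠ 0 →
      ((contrary t (opinion ξ₀ A ω m)).card : ℝ) ≤ (p.β + p.q) / 2 * p.n)
    (hfin : ∀ j, opinion ξ₀ A ω m j ≠ t → (state ξ₀ A ω m).streak j < p.ℓ) :
    ((contrary t (opinion ξ₀ A ω (m + 1))).card : ℝ) ≤ (p.β + p.q) / 2 * p.n := by
  have hle : ((Finset.univ.filter fun j => opinion ξ₀ A ω (m + 1) j ≠ t).card : ℝ) ≤
      p.rho * p.numHonest := by
    rcases eq_or_ne m 0 with rfl | hm0
    · refine le_trans ?_ h.misled_zero.le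
      refine Nat.cast_le.2 (Finset.card_le_card fun j hj => ?_)
      rw [show ξ₀ = opinion ξ₀ A ω 0 from rfl]
      simp only [Finset.mem_filter, Finset.mem_univ, true_and, FPCParams.misled] at hj ⊢
      exact hits_ge_of_opinion_ne h.threshold_zero (hfin j) hj
    · refine le_trans ?_ (h.misled m hm).le
      refine Nat.cast_le.2 (Finset.card_le_card fun j hj => ?_)
      rw [suspects, if_pos (hcard hm0)]
      simp only [Finset.mem_filter, Finset.mem_univ, true_and, FPCParams.misled] at hj ⊢
      exact hits_ge_of_opinion_ne (h.threshold m hm0) (hfin j) hj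
  rw [card_contrary]
  rw [p.rho_mul_numHonest] at hle
  linarith [p.q_mul_n]

theorem misledBit_of_opinion_ne (h : Good t c₀ ξ₀ A u ω) {m : ℕ} (hm : m ≠ 0)
    (hcard : ((contrary t (opinion ξ₀ A ω m)).card : ℝ) ≤ (p.β + p.q) / 2 * p.n)
    {j : p.Honest} (hfin : opinion ξ₀ A ω m j ≠ t → (state ξ₀ A ω m).streak j < p.ℓ)
    (hj : opinion ξ₀ A ω (m + 1) j ≠ t) : misledBit t ξ₀ A j m ω = true := by
  rw [misledBit, decide_eq_true_eq, suspects, if_pos hcard]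
  simp only [Finset.mem_filter, Finset.mem_univ, true_and, FPCParams.misled]
  exact hits_ge_of_opinion_ne (h.threshold m hm) hfin hj

end Good

theorem streak_eq_zero (ξ₀ : p.Honest → Bool) (A : p.Strategy S) (ω : S × p.Path) {m : ℕ}
    (hm : m ≤ p.m₀) (j : p.Honest) : (state ξ₀ A ω m).streak j = 0 := by
  cases m with
  | zero => rfl
  | succ m => exact if_pos hm

theorem streak_succ (ξ₀ : p.Honest → Bool) (A : p.Strategy S) (ω : S × p.Path) {m : ℕ}
    (hm : p.m₀ ≤ m) (j : p.Honest) : (state ξ₀ A ω (m + 1)).streak j =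
      if opinion ξ₀ A ω (m + 1) j = opinion ξ₀ A ω m j then (state ξ₀ A ω m).streak j + 1
      else 1 :=
  if_neg (by omega)

theorem opinion_succ_of_final (ξ₀ : p.Honest → Bool) (A : p.Strategy S) (ω : S × p.Path) {m : ℕ}
    {j : p.Honest} (hm : p.ℓ ≤ (state ξ₀ A ω m).streak j) :
    opinion ξ₀ A ω (m + 1) j = opinion ξ₀ A ω m j :=
  if_pos hm

/-- The race `z` of the bits of a node controls its opinion `o` and its streak `r`: a run of bits
`false` forces the target opinion for as many rounds, and the streak of another opinion is not
longer than the run of bits `true`. -/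
structure Controls (ℓ : ℕ) (t : Bool) (z : Bool × ℕ) (o : Bool) (r : ℕ) : Prop where
  of_false : z.1 = false → o = t ∧ z.2 ≤ r
  of_true : z.1 = true → z.2 < ℓ ∧ (o ≠ t → r ≤ z.2)

theorem Controls.lt {ℓ : ℕ} {t : Bool} {z : Bool × ℕ} {o : Bool} {r : ℕ}
    (h : Controls ℓ t z o r) (ho : o ≠ t) : r < ℓ := by
  cases hz : z.1 with
  | false => exact absurd (h.of_false hz).1 ho
  | true => exact ((h.of_true hz).2 ho).trans_lt (h.of_true hz).1

/-- `Controls` survives a step of the race if the node keeps a final opinion and only adopts an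
opinion other than `t` when the bit `c` is `true`. -/
theorem Controls.step {ℓ : ℕ} {t : Bool} {z : Bool × ℕ} {o : Bool} {r : ℕ}
    (h : Controls ℓ t z o r) {c o' : Bool} (hfin : ℓ ≤ r → o' = o)
    (hc : o' ≠ t → c = true)
    (hz : ¬((raceStep ℓ z c).1 = true ∧ ℓ ≤ (raceStep ℓ z c).2)) :
    Controls ℓ t (raceStep ℓ z c) o' (if o' = o then r + 1 else 1) := by
  obtain ⟨d, n⟩ := z
  have h1 := h.of_false
  have h2 := h.of_true
  constructor
  · intro hd
    by_cases hn : ℓ ≤ n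
    · simp only [raceStep, hn, if_true] at hd ⊢
      obtain ⟨h3, h4⟩ := h1 hd
      have h5 := hfin (hn.trans h4)
      simp only at h4
      simp only [h5, h3, if_true, true_and]
      omega
    · cases c
      · have ho' : o' = t := by
          by_contra hne
          exact absurd (hc hne) (by simp)
        cases d
        · obtain ⟨h3, h4⟩ := h1 rfl
          simp only at h4
          simp only [raceStep, hn, if_false, if_true, ho', h3, true_and]
          omega
        · simp only [raceStep, hn, if_false, Bool.false_eq_true, ho', true_and]
          split_ifs <;> omega
      · cases d <;> simp [raceStep, hn] at hd
  · intro hd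
    refine ⟨not_le.1 fun hle => hz ⟨hd, hle⟩, fun hne => ?_⟩
    obtain rfl := hc hne
    by_cases hn : ℓ ≤ n
    · simp only [raceStep, hn, if_true] at hd
      exact absurd hn (not_le.2 (h2 hd).1)
    · cases d
      · have h3 := (h1 rfl).1
        rw [if_neg fun he => hne (he.trans h3)]
        simp [raceStep, hn]
      · have h4 := (h2 rfl).2
        simp only [raceStep, hn, if_false, if_true]
        split_ifs with he
        · exact Nat.succ_le_succ (h4 (he ▸ hne))
        · omega

namespace Good

variable {t : Bool} {c₀ : ℝ} {ξ₀ : p.Honest → Bool} {A : p.Strategy S} {u : ℕ} {ω : S × p.Path}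

theorem card_contrary_le (h : Good t c₀ ξ₀ A u ω) {m : ℕ} (hm : m < p.m₀) :
    ((contrary t (opinion ξ₀ A ω (m + 1))).card : ℝ) ≤ (p.β + p.q) / 2 * p.n := by
  induction m with
  | zero =>
    refine h.card_contrary_succ (by omega) (fun h0 => absurd rfl h0) fun j _ => ?_
    rw [streak_eq_zero ξ₀ A ω hm.le]
    exact p.ℓ_pos
  | succ m ih =>
    refine h.card_contrary_succ (by omega) (fun _ => ih (by omega)) fun j _ => ?_
    rw [streak_eq_zero ξ₀ A ω hm.le]
    exact p.ℓ_pos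

theorem not_won (h : Good t c₀ ξ₀ A u ω) {n : ℕ} (hn : n ≤ p.ℓ * u) (j : p.Honest) :
    ¬((_root_.race p.ℓ (true, 0) p.m₀ (misledBit t ξ₀ A j · ω) n).1 = true ∧
      p.ℓ ≤ (_root_.race p.ℓ (true, 0) p.m₀ (misledBit t ξ₀ A j · ω) n).2) := by
  intro hwon
  have := h.race j
  rw [race_frozen hn hwon.2] at this
  exact this hwon

/-- On the good event the truncation in `suspects` is not active, and no opinion other than `t`
becomes final. -/
theorem controls (h : Good t c₀ ξ₀ A u ω) {n : ℕ} (hn : n ≤ p.ℓ * u) :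
    ((contrary t (opinion ξ₀ A ω (p.m₀ + n))).card : ℝ) ≤ (p.β + p.q) / 2 * p.n ∧
      ∀ j, Controls p.ℓ t (_root_.race p.ℓ (true, 0) p.m₀ (misledBit t ξ₀ A j · ω) n)
        (opinion ξ₀ A ω (p.m₀ + n) j) ((state ξ₀ A ω (p.m₀ + n)).streak j) := by
  induction n with
  | zero =>
    refine ⟨?_, fun j => ⟨fun h0 => ?_, fun _ => ⟨p.ℓ_pos, fun _ => ?_⟩⟩⟩
    · obtain ⟨m, hm⟩ := Nat.exists_eq_succ_of_ne_zero p.m₀_pos.ne'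
      rw [Nat.add_zero, hm]
      exact h.card_contrary_le (by omega)
    · exact absurd h0 (by simp [_root_.race])
    · exact (streak_eq_zero ξ₀ A ω le_rfl j).le
  | succ n ih =>
    obtain ⟨hcard, hcon⟩ := ih (by omega)
    have hm₀ := p.m₀_pos
    refine ⟨h.card_contrary_succ (m := p.m₀ + n) (by omega) (fun _ => hcard)
      fun j => (hcon j).lt, fun j => ?_⟩
    rw [← Nat.add_assoc, streak_succ ξ₀ A ω (Nat.le_add_right _ _)]
    exact (hcon j).step (opinion_succ_of_final ξ₀ A ω)
      (h.misledBit_of_opinion_ne (by omega) hcard (hcon j).lt) (h.not_won hn j)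

theorem isFinal (h : Good t c₀ ξ₀ A u ω) (j : p.Honest) :
    IsFinal ξ₀ A ω (p.m₀ + p.ℓ * u) j ∧ opinion ξ₀ A ω (p.m₀ + p.ℓ * u) j = t := by
  obtain ⟨s, hs, hblock⟩ := h.block j
  have hend : p.ℓ * s + p.ℓ ≤ p.ℓ * u := by
    rw [← Nat.mul_succ]
    exact Nat.mul_le_mul_left _ hs
  have hfrozen : p.ℓ ≤ (_root_.race p.ℓ (true, 0) p.m₀ (misledBit t ξ₀ A j · ω)
      (p.ℓ * s + p.ℓ)).2 := by
    rcases race_of_forall_false (ℓ := p.ℓ) (z := (true, 0)) (m := p.m₀) (n := p.ℓ * s)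
        (b := fun m => misledBit t ξ₀ A j m ω) hblock p.ℓ_pos with h' | h'
    · exact h'
    · exact h'.2
  rw [← race_frozen hend hfrozen] at hfrozen
  have hfalse : (_root_.race p.ℓ (true, 0) p.m₀ (misledBit t ξ₀ A j · ω) (p.ℓ * u)).1 = false :=
    Bool.eq_false_iff.2 fun htrue => h.race j ⟨htrue, hfrozen⟩
  have hcon := (h.controls le_rfl).2 j
  exact ⟨hfrozen.trans (hcon.of_false hfalse).2, (hcon.of_false hfalse).1⟩

end Good

end Good

/-! ### The probability of the good event -/

section Probability

variable {p : FPCParams} {S : Type*} [MeasurableSpace S]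

theorem ae_uniformInterval {c d : ℝ} (h : c ≤ d) : ∀ᵐ x ∂uniformInterval c d, c ≤ x ∧ x ≤ d := by
  have hmeas : MeasurableSet {x : ℝ | c ≤ x ∧ x ≤ d} := measurableSet_Icc
  rw [uniformInterval, ae_map_iff (by fun_prop) hmeas]
  refine Filter.Eventually.of_forall fun t => ?_
  have h0 := t.2.1
  have h1 := t.2.2
  constructor <;> nlinarith

variable (σ : Measure S)

theorem ae_threshold {m : ℕ} {t : Bool} {c : ℝ}
    (h : ∀ᵐ x ∂p.thresholdLaw m, Protects t c x) :
    ∀ᵐ ω ∂σ.prod p.pathLaw, Protects t c (ω.2 m).2 := by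
  have h1 : ∀ᵐ z ∂p.queriesLaw.prod (p.thresholdLaw m), Protects t c z.2 :=
    Measure.quasiMeasurePreserving_snd.ae h
  rw [← map_eval_pathLaw] at h1
  exact Measure.quasiMeasurePreserving_snd.ae
    (ae_of_ae_map (measurable_pi_apply m).aemeasurable h1)

theorem ae_protects_threshold (t : Bool) :
    ∀ᵐ ω ∂σ.prod p.pathLaw, Protects t (if t then 1 - p.b else p.a) (ω.2 0).2 ∧
      ∀ m, m ≠ 0 → Protects t p.β (ω.2 m).2 := by
  have hβ := p.β_lt_half
  refine (ae_threshold σ ?_).and (ae_all_iff.2 fun m => ?_)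
  · rw [thresholdLaw, if_pos rfl]
    filter_upwards [ae_uniformInterval p.a_le_b] with x hx
    cases t
    · exact hx.1
    · simpa [Protects] using hx.2
  · by_cases hm : m = 0
    · exact Filter.Eventually.of_forall fun _ h => absurd hm h
    refine (ae_threshold σ ?_).mono fun _ h _ => h
    rw [thresholdLaw, if_neg hm]
    filter_upwards [ae_uniformInterval (by linarith : p.β ≤ 1 - p.β)] with x hx
    cases t
    · exact hx.1
    · exact hx.2

variable [IsProbabilityMeasure σ]

/-- Few honest nodes are misled in the first round. -/
theorem real_card_misled_zero_le (hq : p.q < p.β) {t : Bool} {ξ₀ : p.Honest → Bool} {c₀ : ℝ}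
    (hc : ((contrary t ξ₀).card : ℝ) / p.n ≤ c₀)
    (hexp : Real.exp (-2 * p.k * (c₀ - (contrary t ξ₀).card / p.n) ^ 2) ≤
      (p.β - p.q) / (4 * (1 - p.q))) :
    (σ.prod p.pathLaw).real
        {ω | p.rho * p.numHonest ≤ (misled (contrary t ξ₀) c₀ (ω.2 0).1).card} ≤
      Real.exp (-(1 / 8) * p.n * ((p.β - p.q) ^ 2 / (4 * (1 - p.q)))) := by
  have hq1 := p.one_sub_q_pos
  have hn := p.n_pos
  set x := ((contrary t ξ₀).card : ℝ) / p.n with hx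
  have hhit := real_hits_ge_le (D := contrary t ξ₀) (x := x) (t := c₀ - x)
    (div_mul_cancel₀ _ hn.ne').ge (sub_nonneg.2 hc)
  rw [add_sub_cancel] at hhit
  have hmis := real_misled_le (hhit.trans hexp) (t := (p.β - p.q) / (4 * (1 - p.q)))
    (div_nonneg (by linarith) (by linarith))
  -- Both the mean and the deviation are at most half of `rho`.
  have hrho : (p.β - p.q) / (4 * (1 - p.q)) + (p.β - p.q) / (4 * (1 - p.q)) = p.rho := by
    rw [rho]
    field_simp
    ring
  rw [hrho] at hmis
  have hind := real_inter_queries σ (p := p) (m := 0) (A := Set.univ) MeasurableSet.univ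
    {Q | p.rho * p.numHonest ≤ (misled (contrary t ξ₀) c₀ Q).card}
  rw [Set.univ_inter, probReal_univ, mul_one] at hind
  refine (le_of_eq hind).trans (hmis.trans (Real.exp_le_exp.2 ?_))
  rw [← p.one_sub_q_mul_n]
  -- The exponent exceeds the required one by a factor `4`.
  have hcalc : -2 * ((1 - p.q) * p.n) * ((p.β - p.q) / (4 * (1 - p.q))) ^ 2 =
      4 * (-(1 / 8) * p.n * ((p.β - p.q) ^ 2 / (4 * (1 - p.q)))) := by
    field_simp
    ring
  rw [hcalc]
  have : 0 ≤ p.n * ((p.β - p.q) ^ 2 / (4 * (1 - p.q))) := by positivity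
  linarith

/-- The bound for a target opinion `t`, with the initial proportion of contrary nodes in place of
the initial proportion of `1`-opinions. -/
theorem real_consensus_ge (hq : p.q < p.β) (hφ : 0 < p.phi) (A : p.Strategy S)
    (ξ₀ : p.Honest → Bool) (u : ℕ) {t : Bool}
    (hc : ((contrary t ξ₀).card : ℝ) / p.n ≤ if t then 1 - p.b else p.a)
    (hexp : Real.exp (-2 * p.k * ((if t then 1 - p.b else p.a) -
      (contrary t ξ₀).card / p.n) ^ 2) ≤ (p.β - p.q) / (4 * (1 - p.q))) :
    (σ.prod p.pathLaw).real
        (finalConsensus ξ₀ A t ∩ {ω | numRounds ξ₀ A ω ≤ ((p.m₀ + p.ℓ * u : ℕ) : ℕ∞)}) ≥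
      1 - Real.exp (-(1 / 8) * p.n * ((p.β - p.q) ^ 2 / (4 * (1 - p.q)))) - p.W u := by
  -- The event fails only on a null set `Z`, when too many nodes are misled in the first round
  -- (`B₀`) or in some round (`B m`), or when a node `j` has a long run of misled rounds (`R j`) or no
  -- undisturbed block (`K j`).
  set c₀ : ℝ := if t then 1 - p.b else p.a with hc₀
  set P := σ.prod p.pathLaw with hP
  set E := finalConsensus ξ₀ A t ∩ {ω | numRounds ξ₀ A ω ≤ ((p.m₀ + p.ℓ * u : ℕ) : ℕ∞)} with hE
  set Z : Set (S × p.Path) := {ω | ¬(Protects t c₀ (ω.2 0).2 ∧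
    ∀ m, m ≠ 0 → Protects t p.β (ω.2 m).2)} with hZ
  set B₀ : Set (S × p.Path) :=
    {ω | p.rho * p.numHonest ≤ (misled (contrary t ξ₀) c₀ (ω.2 0).1).card} with hB₀
  set B : Fin (p.m₀ + p.ℓ * u) → Set (S × p.Path) := fun m =>
    {ω | p.rho * p.numHonest ≤ (misled (suspects t ξ₀ A m ω) p.β (ω.2 m).1).card} with hB
  set R : p.Honest → Set (S × p.Path) := fun j =>
    {ω | (race p.ℓ (true, 0) p.m₀ (misledBit t ξ₀ A j · ω) (p.ℓ * u)).1 = true ∧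
      p.ℓ ≤ (race p.ℓ (true, 0) p.m₀ (misledBit t ξ₀ A j · ω) (p.ℓ * u)).2} with hR
  set K : p.Honest → Set (S × p.Path) := fun j =>
    {ω | ∀ s < u, ∃ i < p.ℓ, misledBit t ξ₀ A j (p.m₀ + p.ℓ * s + i) ω = true} with hK
  have hcover : Set.univ ⊆ E ∪ (Z ∪ (B₀ ∪ ((⋃ m, B m) ∪ ((⋃ j, R j) ∪ ⋃ j, K j)))) := by
    intro ω _
    by_contra hω
    simp only [Set.mem_union, Set.mem_iUnion, not_or, not_exists] at hω
    obtain ⟨hωE, hωZ, hωB₀, hωB, hωR, hωK⟩ := hω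
    have hZ' := not_not.1 hωZ
    have hgood : Good t c₀ ξ₀ A u ω :=
      { threshold_zero := hZ'.1
        threshold := hZ'.2
        misled_zero := not_le.1 hωB₀
        misled := fun m hm => not_le.1 (hωB ⟨m, hm⟩)
        race := hωR
        block := fun j => by
          by_contra hne
          push Not at hne
          exact hωK j fun s hs => by simpa using hne s hs }
    refine hωE ⟨fun j => ⟨_, hgood.isFinal j⟩, ?_⟩
    exact iInf₂_le (f := fun (m : ℕ) (_ : ∀ j, IsFinal ξ₀ A ω m j) => (m : ℕ∞)) _
      fun j => (hgood.isFinal j).1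
  have hone := measureReal_mono (μ := P) hcover
  rw [probReal_univ] at hone
  have hZ0 : P.real Z = 0 := by
    rw [measureReal_def, show P Z = 0 from ae_iff.1 (ae_protects_threshold σ t),
      ENNReal.toReal_zero]
  have hB₀le := real_card_misled_zero_le σ hq hc hexp
  have hε1 := p.eps_lt_one hφ
  have hBle : P.real (⋃ m, B m) ≤
      (p.m₀ + p.ℓ * u) * Real.exp (-2 * (1 - p.q) * p.n * p.phi ^ 2) := by
    have hle (m) : P.real (B m) ≤ _ := real_card_misled_le σ hq.le hφ.le t ξ₀ A m
    refine (measureReal_iUnion_fintype_le B).trans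
      ((Finset.sum_le_sum fun m _ => hle m).trans (le_of_eq ?_))
    rw [Finset.sum_const, Finset.card_univ, Fintype.card_fin, nsmul_eq_mul, ← p.one_sub_q_mul_n]
    push_cast
    ring_nf
  have hRle : P.real (⋃ j, R j) ≤ p.numHonest * (p.eps / (1 - p.eps)) ^ (p.ℓ - 1) := by
    refine (measureReal_iUnion_fintype_le R).trans ((Finset.sum_le_sum fun j _ =>
      (adaptedBits_misledBit σ hq.le t ξ₀ A j p.m₀).race_le p.eps_pos hε1 p.ℓ_pos _).trans
        (le_of_eq ?_))
    rw [Finset.sum_const, Finset.card_univ, Fintype.card_fin, nsmul_eq_mul]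
  have hKle : P.real (⋃ j, K j) ≤ p.numHonest * (1 - (1 - p.eps) ^ p.ℓ) ^ u := by
    refine (measureReal_iUnion_fintype_le K).trans ((Finset.sum_le_sum fun j _ =>
      (adaptedBits_misledBit σ hq.le t ξ₀ A j p.m₀).forall_block_exists_le hε1.le p.eps_pos.le
        p.ℓ u).trans (le_of_eq ?_))
    rw [Finset.sum_const, Finset.card_univ, Fintype.card_fin, nsmul_eq_mul]
  have hW : p.W u = p.numHonest * ((1 - (1 - p.eps) ^ p.ℓ) ^ u +
      (p.eps / (1 - p.eps)) ^ (p.ℓ - 1)) +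
      (p.m₀ + p.ℓ * u) * Real.exp (-2 * (1 - p.q) * p.n * p.phi ^ 2) := by
    rw [W, p.one_sub_q_mul_n]
    rfl
  have h1 := measureReal_union_le (μ := P) E (Z ∪ (B₀ ∪ ((⋃ m, B m) ∪ ((⋃ j, R j) ∪ ⋃ j, K j))))
  have h2 := measureReal_union_le (μ := P) Z (B₀ ∪ ((⋃ m, B m) ∪ ((⋃ j, R j) ∪ ⋃ j, K j)))
  have h3 := measureReal_union_le (μ := P) B₀ ((⋃ m, B m) ∪ ((⋃ j, R j) ∪ ⋃ j, K j))
  have h4 := measureReal_union_le (μ := P) (⋃ m, B m) ((⋃ j, R j) ∪ ⋃ j, K j)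
  have h5 := measureReal_union_le (μ := P) (⋃ j, R j) (⋃ j, K j)
  rw [hW, ge_iff_le]
  linarith

theorem card_contrary_div (t : Bool) (ξ₀ : p.Honest → Bool) :
    ((contrary t ξ₀).card : ℝ) / p.n =
      if t then 1 - initialProportion ξ₀ * (1 - p.q)
      else initialProportion ξ₀ * (1 - p.q) + p.q := by
  have hn := p.n_pos.ne'
  have hN := p.numHonest_pos_real.ne'
  have hone : initialProportion ξ₀ * (1 - p.q) * p.n =
      ((Finset.univ.filter fun j => ξ₀ j = true).card : ℝ) := by
    rw [mul_assoc, p.one_sub_q_mul_n, initialProportion, div_mul_cancel₀ _ hN]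
  rw [div_eq_iff hn, card_contrary]
  cases t
  · simp only [Bool.false_eq_true, if_false, ne_eq, Bool.not_eq_false, add_mul, hone, p.q_mul_n]
    ring
  · have hsum := Finset.card_filter_add_card_filter_not (s := (Finset.univ : Finset p.Honest))
      (fun j => ξ₀ j = true)
    rw [Finset.card_univ, Fintype.card_fin] at hsum
    have hsum' : ((Finset.univ.filter fun j => ξ₀ j = true).card : ℝ) +
      ((Finset.univ.filter fun j => ξ₀ j ≠ true).card : ℝ) = p.numHonest := by exact_mod_cast hsum
    simp only [if_true, sub_mul, one_mul, hone]
    linarith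

end Probability

end FPCParams

end

theorem theorem2 (p : FPCParams) (hq : p.q < p.β) (hφ : 0 < p.phi)
    {S : Type*} [MeasurableSpace S] (σ : Measure S) [IsProbabilityMeasure σ]
    (A : p.Strategy S) (ξ₀ : p.Honest → Bool) (u : ℕ) :
    (FPCParams.initialProportion ξ₀ * (1 - p.q) + p.q < p.a →
      Real.exp (-2 * p.k * (p.a - FPCParams.initialProportion ξ₀ * (1 - p.q) - p.q) ^ 2)
        ≤ (p.β - p.q) / (4 * (1 - p.q)) →
      (σ.prod p.pathLaw).real
          (FPCParams.finalConsensus ξ₀ A false ∩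
            {ω | FPCParams.numRounds ξ₀ A ω ≤ ((p.m₀ + p.ℓ * u : ℕ) : ℕ∞)})
        ≥ 1 - Real.exp (-(1 / 8) * p.n * ((p.β - p.q) ^ 2 / (4 * (1 - p.q)))) - p.W u) ∧
    (FPCParams.initialProportion ξ₀ * (1 - p.q) > p.b →
      Real.exp (-2 * p.k * (FPCParams.initialProportion ξ₀ * (1 - p.q) - p.b) ^ 2)
        ≤ (p.β - p.q) / (4 * (1 - p.q)) →
      (σ.prod p.pathLaw).real
          (FPCParams.finalConsensus ξ₀ A true ∩
            {ω | FPCParams.numRounds ξ₀ A ω ≤ ((p.m₀ + p.ℓ * u : ℕ) : ℕ∞)})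
        ≥ 1 - Real.exp (-(1 / 8) * p.n * ((p.β - p.q) ^ 2 / (4 * (1 - p.q)))) - p.W u) := by
  refine ⟨fun hlt hexp => ?_, fun hlt hexp => ?_⟩
  · have hx := FPCParams.card_contrary_div false ξ₀
    simp only [Bool.false_eq_true, if_false] at hx
    refine FPCParams.real_consensus_ge σ hq hφ A ξ₀ u (t := false) ?_ ?_ <;>
      rw [hx] <;> simp only [Bool.false_eq_true, if_false]
    · exact hlt.le
    · rwa [← sub_sub]
  · have hx := FPCParams.card_contrary_div true ξ₀
    simp only [if_true] at hx
    refine FPCParams.real_consensus_ge σ hq hφ A ξ₀ u (t := true) ?_ ?_ <;>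
      rw [hx] <;> simp only [if_true]
    · linarith
    · rwa [sub_sub_sub_cancel_left]
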